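/- Let $\bar r,\bar a,\underline d,\bar d$ be constants with $\underline d>0$. There are constants $C_1,C_2$, depending only on $\bar r,\bar a,\underline d,\bar d$, such that the following holds for all $m,n\in\mathbb{N}^+$, all data sets $\mathcal{D}=\{(r_j,\boldsymbol a_j):1\le j\le n\}$ with $r_j\in\mathbb{R}$, $\boldsymbol a_j\in\mathbb{R}^m$ (entries of any sign), $|r_j|\le\bar r$, $\|\boldsymbol a_j\|_\infty\le\bar a$, and all $\boldsymbol d\in\mathbb{R}^m$ with $\underline d\le d_i\le\bar d$ for $i=1,\dots,m$. Assume that the data are in general position: for every price vector $\boldsymbol p\in\mathbb{R}^m$, $\boldsymbol p\ge\boldsymbol 0$, at most $m$ indices $j$ satisfy $\boldsymbol a_j^\top\boldsymbol p=r_j$. Put $\boldsymbol b=n\boldsymbol d$ and let $$R_n^*=\max\Big\{\sum_{j=1}^n r_jx_j:\ \sum_{j=1}^n\boldsymbol a_jx_j\le\boldsymbol b,\ 0\le x_j\le1\ (1\le j\le n)\Big\}.$$ Let the pairs arrive in uniformly random order, i.e. let $\sigma$ be a uniformly random permutation of $\{1,\dots,n\}$ and let the pair observed at time $t$ be $(r_{\sigma(t)},\boldsymbol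 a_{\sigma(t)})$. Run the following algorithm with step sizes $\gamma_t=1/\sqrt n$: start with $\boldsymbol p_1=\boldsymbol 0$, and for $t=1,\dots,n$ set $x_t=1$ if $r_{\sigma(t)}>\boldsymbol a_{\sigma(t)}^\top\boldsymbol p_t$ and $x_t=0$ otherwise, and $\boldsymbol p_{t+1}=\big(\boldsymbol p_t+\gamma_t(\boldsymbol a_{\sigma(t)}x_t-\boldsymbol d)\big)\vee\boldsymbol 0$, where $\vee$ is the elementwise maximum. Let $R_n=\sum_{t=1}^n r_{\sigma(t)}x_t$ be the objective value obtained and $v(\boldsymbol x)=\big\|\big(\sum_{t=1}^n\boldsymbol a_{\sigma(t)}x_t-\boldsymbol b\big)^+\big\|_2$ the constraint violation. Then, with expectations over $\sigma$, $$R_n^*-\mathbb{E}[R_n]\le C_1\,(m+\log n)\sqrt n\qquad\text{and}\qquad\mathbb{E}[v(\boldsymbol x)]\le C_2\,m\sqrt n .$$ -/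

import Mathlib

open scoped BigOperators

noncomputable section

namespace OnlineLP

/-- The columns of an (integer) linear program with `n` decision variables and `m` constraints:
the rewards `r j` and the constraint columns `a j`, so that `a j i` is the entry of the
constraint matrix in row `i` and column `j`. -/
structure LPData (m n : ℕ) where
  /-- The coefficient of the `j`-th variable in the objective. -/
  r : Fin n → ℝ
  /-- The `j`-th column of the constraint matrix. -/
  a : Fin n → Fin m → ℝ

variable {m n : ℕ}

/-- The data set in the order of arrival `σ`: the pair arriving at time `t` is the pair with
index `σ t`. -/
def LPData.permute (D : LPData m n) (σ : Equiv.Perm (Fin n)) : LPData m n where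
  r := fun t => D.r (σ t)
  a := fun t => D.a (σ t)

/-- `|r_j| ≤ rbar` and `‖a_j‖_∞ ≤ abar` for all `j` (the norm of `Fin m → ℝ` is the sup norm). -/
def LPData.BoundedBy (D : LPData m n) (rbar abar : ℝ) : Prop :=
  ∀ j, |D.r j| ≤ rbar ∧ ‖D.a j‖ ≤ abar

/-- General position: for every price vector `p ≥ 0`, at most `m` of the columns satisfy
`a_jᵀ p = r_j`. -/
def LPData.GeneralPosition (D : LPData m n) : Prop :=
  ∀ p : Fin m → ℝ, 0 ≤ p → {j : Fin n | D.a j ⬝ᵥ p = D.r j}.ncard ≤ m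

/-- The objective value `rᵀ x`. -/
def LPData.objective (D : LPData m n) (x : Fin n → ℝ) : ℝ :=
  ∑ j, D.r j * x j

/-- The resource consumption `A x`. -/
def LPData.consumption (D : LPData m n) (x : Fin n → ℝ) : Fin m → ℝ :=
  fun i => ∑ j, D.a j i * x j

/-- The feasible set `{x | A x ≤ b, 0 ≤ x ≤ 1}` of the linear programming relaxation. -/
def LPData.feasible (D : LPData m n) (b : Fin m → ℝ) : Set (Fin n → ℝ) :=
  {x | D.consumption x ≤ b ∧ 0 ≤ x ∧ x ≤ 1}

/-- The optimal value of the linear programming relaxation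
`max rᵀ x` subject to `A x ≤ b`, `0 ≤ x ≤ 1`. -/
def LPData.optimalValue (D : LPData m n) (b : Fin m → ℝ) : ℝ :=
  sSup (D.objective '' D.feasible b)

/-- For `b ≥ 0` the supremum in `optimalValue` is a maximum. -/
theorem LPData.isGreatest_optimalValue (D : LPData m n) (b : Fin m → ℝ) (hb : 0 ≤ b) :
    IsGreatest (D.objective '' D.feasible b) (D.optimalValue b) := by
  have hne : (D.feasible b).Nonempty := by
    refine ⟨0, ?_, le_refl _, zero_le_one⟩
    intro i
    simpa [LPData.consumption] using hb i
  have hc : IsCompact (D.feasible b) := by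
    have hclosed : IsClosed {x : Fin n → ℝ | D.consumption x ≤ b} := by
      refine isClosed_le ?_ continuous_const
      unfold LPData.consumption
      fun_prop
    exact (isCompact_Icc (a := (0 : Fin n → ℝ)) (b := 1)).inter_left hclosed
  have hcont : Continuous D.objective := by
    unfold LPData.objective
    fun_prop
  exact (hc.image hcont).isGreatest_sSup (hne.image _)

/-- The thresholding rule: accept (`1`) if `r > aᵀ p`, otherwise reject (`0`). -/
def threshold (r : ℝ) (a p : Fin m → ℝ) : ℝ :=
  if a ⬝ᵥ p < r then 1 else 0

/-- The dual prices of the simple online algorithm with step sizes `γ`, run on the columns of `D`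
in their given order with `d = b / n`. Time is counted from `0`: `dualPrice D d γ t` is the price
vector after `t` columns have been processed, that is, the one used for column `t`. It starts
at `0`, and the update is `p ↦ (p + γ_t (a_t x_t - d)) ∨ 0`. After the last column it stays
constant. -/
def dualPrice (D : LPData m n) (d : Fin m → ℝ) (γ : Fin n → ℝ) : ℕ → Fin m → ℝ
  | 0 => 0
  | t + 1 =>
    if h : t < n then
      (dualPrice D d γ t + γ ⟨t, h⟩ •
        (threshold (D.r ⟨t, h⟩) (D.a ⟨t, h⟩) (dualPrice D d γ t) • D.a ⟨t, h⟩ - d)) ⊔ 0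
    else dualPrice D d γ t

/-- The output `x = (x_1, …, x_n)` of the simple online algorithm. -/
def algorithmOutput (D : LPData m n) (d : Fin m → ℝ) (γ : Fin n → ℝ) : Fin n → ℝ :=
  fun t => threshold (D.r t) (D.a t) (dualPrice D d γ t)

/-- The constraint violation `‖(A x - b)⁺‖₂`. -/
def LPData.violation (D : LPData m n) (b : Fin m → ℝ) (x : Fin n → ℝ) : ℝ :=
  ‖(WithLp.toLp 2 (fun i => max (D.consumption x i - b i) 0) : EuclideanSpace ℝ (Fin m))‖

/-- The constant step sizes `γ_t = 1 / √n`. -/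
def constStep (n : ℕ) : Fin n → ℝ := fun _ => 1 / √(n : ℝ)

/-- The expected objective value `E[R_n]` of the algorithm (with `b = n d` and step size
`1 / √n`) when the columns arrive in uniformly random order: the average over all
permutations. -/
def expectedReward (D : LPData m n) (d : Fin m → ℝ) : ℝ :=
  𝔼 σ : Equiv.Perm (Fin n),
    (D.permute σ).objective (algorithmOutput (D.permute σ) d (constStep n))

/-- The expected constraint violation `E[v(x)]` of the algorithm (with `b = n d` and step size
`1 / √n`) when the columns arrive in uniformly random order. -/
def expectedViolation (D : LPData m n) (d : Fin m → ℝ) : ℝ :=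
  𝔼 σ : Equiv.Perm (Fin n),
    (D.permute σ).violation ((n : ℝ) • d) (algorithmOutput (D.permute σ) d (constStep n))

end OnlineLP

end

open scoped BigOperators

noncomputable section

/-! The algorithm is projected subgradient descent on the dual function `d ⬝ᵥ p + max (r - a ⬝ᵥ p)
0`, one column at a time, and `‖p‖²` serves as potential.

Violation: a column is accepted only when `a ⬝ᵥ p < r`, so large prices drift downwards because `d ≥
dlow > 0`. Hence `‖p‖₂ = O(m)`, and the violation is at most `√n` times the final price
(`dualPrice_dotProduct_self_le`, `violation_le`).

Regret: telescoping the potential bounds the dual terms along the price path by the reward plus `O(m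
√n)` (`sum_dualTerm_le_objective`). The price at time `t` depends only on the past, so the expected
dual term at `t` equals its expected average over the `s` remaining columns
(`card_mul_expect_dualTerm`). The offline optimum restricted to these columns overshoots the budget
`s d` by `O(√(m s))` on average, by the variance bound for sampling without replacement. After
rescaling, weak duality applies at every `p ≥ 0`, so dependence between the price and the remaining
columns is harmless. The loss per step is `O(√(m / s))`, which sums to `O(√(m n))`. -/

namespace OnlineLP

/-! ### Sampling without replacement -/

section Permutations

variable {n : ℕ}

/-- The expectation over a uniformly random permutation is invariant under reordering. -/
theorem expect_perm_mul_right (τ : Equiv.Perm (Fin n)) (φ : Equiv.Perm (Fin n) → ℝ) :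
    𝔼 σ, φ (σ * τ) = 𝔼 σ, φ σ :=
  Fintype.expect_equiv (Equiv.mulRight τ) _ _ fun _ => rfl

theorem expect_apply_eq (z : Fin n → ℝ) (k : Fin n) :
    𝔼 σ : Equiv.Perm (Fin n), z (σ k) = (∑ j, z j) / n := by
  have hn : (n : ℝ) ≠ 0 := by
    have := k.pos
    positivity
  have h : ∀ l : Fin n, 𝔼 σ : Equiv.Perm (Fin n), z (σ l) =
      𝔼 σ : Equiv.Perm (Fin n), z (σ k) := by
    intro l
    rw [← expect_perm_mul_right (Equiv.swap k l) fun σ => z (σ l)]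
    simp
  have hs : ∑ l : Fin n, 𝔼 σ : Equiv.Perm (Fin n), z (σ l) = ∑ j, z j := by
    rw [← Finset.expect_sum_comm]
    simp_rw [Equiv.sum_comp]
    exact Fintype.expect_const _
  rw [eq_div_iff hn, ← hs, Finset.sum_congr rfl fun l _ => h l]
  simp [mul_comm]

/-- Distinct draws without replacement from centered data are negatively correlated. -/
theorem expect_mul_nonpos (z : Fin n → ℝ) (hz : ∑ j, z j = 0) {k l : Fin n} (hkl : k ≠ l) :
    𝔼 σ : Equiv.Perm (Fin n), z (σ k) * z (σ l) ≤ 0 := by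
  have h : ∀ l' ∈ Finset.univ.erase k, 𝔼 σ : Equiv.Perm (Fin n), z (σ k) * z (σ l') =
      𝔼 σ : Equiv.Perm (Fin n), z (σ k) * z (σ l) := by
    intro l' hl'
    rw [← expect_perm_mul_right (Equiv.swap l l') fun σ => z (σ k) * z (σ l')]
    have hk : k ≠ l' := (Finset.ne_of_mem_erase hl').symm
    simp [Equiv.swap_apply_of_ne_of_ne hkl hk]
  have hs : ∑ l' ∈ Finset.univ.erase k, 𝔼 σ : Equiv.Perm (Fin n), z (σ k) * z (σ l') ≤ 0 := by
    rw [← Finset.expect_sum_comm]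
    refine Finset.expect_le Finset.univ_nonempty fun σ _ => ?_
    -- Centering makes the other draws sum to `-z (σ k)`, so the products sum to `-z (σ k) ^ 2`.
    have h1 : z (σ k) + ∑ l' ∈ Finset.univ.erase k, z (σ l') = 0 := by
      rw [Finset.add_sum_erase _ (fun l' => z (σ l')) (Finset.mem_univ k), Equiv.sum_comp, hz]
    rw [← Finset.mul_sum, eq_neg_of_add_eq_zero_right h1]
    nlinarith [sq_nonneg (z (σ k))]
  rw [Finset.sum_congr rfl h, Finset.sum_const, nsmul_eq_mul] at hs
  have hc : 0 < ((Finset.univ.erase k).card : ℝ) := by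
    exact_mod_cast Finset.card_pos.2 ⟨l, by simp [hkl.symm]⟩
  by_contra! hneg
  exact absurd hs (not_le.2 (mul_pos hc hneg))

/-- The variance of a sum of draws without replacement is at most that with replacement. -/
theorem expect_sum_sub_mean_sq_le (y : Fin n → ℝ) {A : ℝ} (hy : ∀ j, |y j| ≤ A)
    (S : Finset (Fin n)) :
    𝔼 σ : Equiv.Perm (Fin n), (∑ k ∈ S, (y (σ k) - (∑ j, y j) / n)) ^ 2 ≤ S.card * A ^ 2 := by
  rcases Nat.eq_zero_or_pos n with rfl | hn
  · have : S = ∅ := by ext x; exact x.elim0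
    simp [this]
  have hn0 : (0 : ℝ) < n := by exact_mod_cast hn
  set μ := (∑ j, y j) / n with hμ
  have hsum : ∑ j, y j = n * μ := by rw [hμ]; field_simp
  have hz : ∑ j, (y j - μ) = 0 := by simp [Finset.sum_sub_distrib, hsum]
  have hdiag : ∀ k, 𝔼 σ : Equiv.Perm (Fin n), (y (σ k) - μ) * (y (σ k) - μ) ≤ A ^ 2 := by
    intro k
    rw [expect_apply_eq (fun j => (y j - μ) * (y j - μ)) k, div_le_iff₀ hn0]
    have h1 : ∑ j, (y j - μ) * (y j - μ) = ∑ j, y j ^ 2 - n * μ ^ 2 := by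
      have : ∀ j, (y j - μ) * (y j - μ) = y j ^ 2 - 2 * μ * y j + μ ^ 2 := fun j => by ring
      simp_rw [this, Finset.sum_add_distrib, Finset.sum_sub_distrib, ← Finset.mul_sum, hsum]
      simp
      ring
    have h2 : ∑ j, y j ^ 2 ≤ n * A ^ 2 := by
      calc ∑ j, y j ^ 2 ≤ ∑ _j : Fin n, A ^ 2 :=
            Finset.sum_le_sum fun j _ => sq_le_sq' (abs_le.1 (hy j)).1 (abs_le.1 (hy j)).2
        _ = n * A ^ 2 := by simp
    rw [h1]
    nlinarith [mul_nonneg hn0.le (sq_nonneg μ)]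
  have hexp : 𝔼 σ : Equiv.Perm (Fin n), (∑ k ∈ S, (y (σ k) - μ)) ^ 2 =
      ∑ k ∈ S, ∑ l ∈ S, 𝔼 σ : Equiv.Perm (Fin n), (y (σ k) - μ) * (y (σ l) - μ) := by
    simp_rw [sq, Finset.sum_mul_sum, ← Finset.expect_sum_comm]
  rw [hexp]
  calc _ ≤ ∑ _k ∈ S, A ^ 2 := by
        refine Finset.sum_le_sum fun k hk => ?_
        rw [← Finset.add_sum_erase _ _ hk]
        have := Finset.sum_nonpos (s := S.erase k)
          (f := fun l => 𝔼 σ : Equiv.Perm (Fin n), (y (σ k) - μ) * (y (σ l) - μ))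
          fun l hl => expect_mul_nonpos (fun j => y j - μ) hz (Finset.ne_of_mem_erase hl).symm
        linarith [hdiag k]
    _ = S.card * A ^ 2 := by simp

end Permutations

/-! ### The threshold rule and the price recursion -/

variable {m n : ℕ}

theorem LPData.BoundedBy.permute {D : LPData m n} {rbar abar : ℝ} (h : D.BoundedBy rbar abar)
    (σ : Equiv.Perm (Fin n)) : (D.permute σ).BoundedBy rbar abar :=
  fun j => h (σ j)

theorem LPData.BoundedBy.abs_entry_le {D : LPData m n} {rbar abar : ℝ}
    (h : D.BoundedBy rbar abar) (j : Fin n) (i : Fin m) : |D.a j i| ≤ abar :=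
  (norm_le_pi_norm (D.a j) i).trans (h j).2

theorem threshold_nonneg (r : ℝ) (a p : Fin m → ℝ) : 0 ≤ threshold r a p := by
  unfold threshold; split_ifs <;> norm_num

theorem threshold_le_one (r : ℝ) (a p : Fin m → ℝ) : threshold r a p ≤ 1 := by
  unfold threshold; split_ifs <;> norm_num

theorem threshold_mul_dotProduct_le {r rbar : ℝ} (hr : |r| ≤ rbar) (a p : Fin m → ℝ) :
    threshold r a p * (a ⬝ᵥ p) ≤ rbar := by
  unfold threshold
  split_ifs with h
  · linarith [le_abs_self r]
  · linarith [abs_nonneg r]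

theorem max_sub_dotProduct_eq (r : ℝ) (a p : Fin m → ℝ) :
    max (r - a ⬝ᵥ p) 0 = threshold r a p * (r - a ⬝ᵥ p) := by
  unfold threshold
  split_ifs with h
  · rw [max_eq_left (by linarith), one_mul]
  · rw [max_eq_right (by linarith), zero_mul]

theorem dualPrice_nonneg (D : LPData m n) (d : Fin m → ℝ) (γ : Fin n → ℝ) (t : ℕ) :
    0 ≤ dualPrice D d γ t := by
  induction t with
  | zero => exact le_refl _
  | succ t ih =>
    rw [dualPrice]
    split_ifs
    · exact le_sup_right
    · exact ih

theorem dualPrice_succ (D : LPData m n) (d : Fin m → ℝ) (γ : Fin n → ℝ) (t : Fin n) :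
    dualPrice D d γ (t + 1) = (dualPrice D d γ t + γ t •
      (algorithmOutput D d γ t • D.a t - d)) ⊔ 0 := by
  rw [dualPrice, dif_pos t.2]
  rfl

/-- The price at time `t` depends only on the columns that arrive before `t`. -/
theorem dualPrice_congr {D D' : LPData m n} (d : Fin m → ℝ) (γ : Fin n → ℝ) (t : ℕ)
    (hr : ∀ j : Fin n, (j : ℕ) < t → D.r j = D'.r j)
    (ha : ∀ j : Fin n, (j : ℕ) < t → D.a j = D'.a j) :
    dualPrice D d γ t = dualPrice D' d γ t := by
  induction t with
  | zero => rfl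
  | succ t ih =>
    rw [dualPrice, dualPrice, ih (fun j hj => hr j (hj.trans t.lt_succ_self))
      fun j hj => ha j (hj.trans t.lt_succ_self)]
    split_ifs with h
    · rw [hr ⟨t, h⟩ t.lt_succ_self, ha ⟨t, h⟩ t.lt_succ_self]
    · rfl

/-! ### Potential argument for bounded prices -/

/-- The subgradient step with projection on the nonnegative orthant. -/
theorem sup_zero_dotProduct_self_le (p g : Fin m → ℝ) (c : ℝ) :
    ((p + c • g) ⊔ 0) ⬝ᵥ ((p + c • g) ⊔ 0) ≤ p ⬝ᵥ p + 2 * c * (p ⬝ᵥ g) + c ^ 2 * (g ⬝ᵥ g) := by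
  simp only [dotProduct, Finset.mul_sum, ← Finset.sum_add_distrib]
  refine Finset.sum_le_sum fun i _ => ?_
  simp only [Pi.sup_apply, Pi.add_apply, Pi.smul_apply, smul_eq_mul, Pi.zero_apply]
  rcases le_total (p i + c * g i) 0 with h | h
  · rw [sup_eq_right.2 h]
    nlinarith [sq_nonneg (p i + c * g i)]
  · rw [sup_eq_left.2 h]
    apply le_of_eq
    ring

theorem residual_dotProduct_self_le {D : LPData m n} {rbar abar dbar : ℝ} {d : Fin m → ℝ}
    (hD : D.BoundedBy rbar abar) (hd0 : 0 ≤ d) (hd : ∀ i, d i ≤ dbar) (γ : Fin n → ℝ)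
    (t : Fin n) :
    (algorithmOutput D d γ t • D.a t - d) ⬝ᵥ (algorithmOutput D d γ t • D.a t - d) ≤
      m * (abar + dbar) ^ 2 := by
  calc _ ≤ ∑ _i : Fin m, (abar + dbar) ^ 2 := by
        refine Finset.sum_le_sum fun i _ => ?_
        simp only [Pi.sub_apply, Pi.smul_apply, smul_eq_mul]
        have h1 : |algorithmOutput D d γ t * D.a t i| ≤ abar := by
          rw [abs_mul, algorithmOutput, abs_of_nonneg (threshold_nonneg _ _ _)]
          exact (mul_le_of_le_one_left (abs_nonneg _) (threshold_le_one _ _ _)).trans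
            (hD.abs_entry_le t i)
        have h2 := abs_le.1 h1
        rw [← sq]
        exact sq_le_sq' (by linarith [hd i]) (by linarith [hd i, show 0 ≤ d i from hd0 i])
    _ = m * (abar + dbar) ^ 2 := by simp

theorem dualPrice_succ_dotProduct_self_le {D : LPData m n} {rbar abar dbar : ℝ} {d : Fin m → ℝ}
    (hD : D.BoundedBy rbar abar) (hd0 : 0 ≤ d) (hd : ∀ i, d i ≤ dbar) (t : Fin n) :
    dualPrice D d (constStep n) (t + 1) ⬝ᵥ dualPrice D d (constStep n) (t + 1) ≤
      dualPrice D d (constStep n) t ⬝ᵥ dualPrice D d (constStep n) t +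
        2 * (1 / √(n : ℝ)) * (dualPrice D d (constStep n) t ⬝ᵥ
          (algorithmOutput D d (constStep n) t • D.a t - d)) +
        (1 / √(n : ℝ)) ^ 2 * (m * (abar + dbar) ^ 2) := by
  rw [dualPrice_succ]
  refine (sup_zero_dotProduct_self_le _ _ _).trans ?_
  have := mul_le_mul_of_nonneg_left (residual_dotProduct_self_le hD hd0 hd (constStep n) t)
    (sq_nonneg (constStep n t))
  unfold constStep at *
  linarith

/-- The dual prices of the algorithm stay bounded. -/
theorem dualPrice_dotProduct_self_le {D : LPData m n} {rbar abar dlow dbar : ℝ} {d : Fin m → ℝ}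
    (hdlow : 0 < dlow) (hD : D.BoundedBy rbar abar) (hd : ∀ i, dlow ≤ d i ∧ d i ≤ dbar)
    (hn : 0 < n) (t : ℕ) :
    dualPrice D d (constStep n) t ⬝ᵥ dualPrice D d (constStep n) t ≤
      ((2 * rbar + m * (abar + dbar) ^ 2) / (2 * dlow)) ^ 2 +
        (2 * rbar + m * (abar + dbar) ^ 2) := by
  have hrbar : 0 ≤ rbar := (abs_nonneg _).trans (hD ⟨0, hn⟩).1
  have hd0 : 0 ≤ d := fun i => hdlow.le.trans (hd i).1
  set G := (m : ℝ) * (abar + dbar) ^ 2 with hG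
  have hG0 : 0 ≤ G := by positivity
  -- Once `∑ i, p i ≥ K`, the potential cannot increase. Below `K ^ 2` a single step adds at most `2
  -- * rbar + G`, as the step size is at most `1`.
  set K := (2 * rbar + G) / (2 * dlow) with hK
  have hK0 : 0 ≤ K := by positivity
  induction t with
  | zero => simp [dualPrice]; positivity
  | succ t ih =>
    by_cases h : t < n
    swap
    · rwa [dualPrice, dif_neg h]
    have hstep := dualPrice_succ_dotProduct_self_le hD hd0 (fun i => (hd i).2) ⟨t, h⟩
    simp only at hstep
    set p := dualPrice D d (constStep n) t with hp
    have hp0 : 0 ≤ p := dualPrice_nonneg _ _ _ _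
    set c := 1 / √(n : ℝ) with hc
    have hc0 : 0 < c := by positivity
    have hc1 : c ≤ 1 := by
      rw [hc, div_le_one (by positivity)]
      exact Real.one_le_sqrt.2 (by exact_mod_cast hn)
    have hsum0 : 0 ≤ ∑ i, p i := Finset.sum_nonneg fun i _ => hp0 i
    have hdrift : p ⬝ᵥ (algorithmOutput D d (constStep n) ⟨t, h⟩ • D.a ⟨t, h⟩ - d) ≤
        rbar - dlow * ∑ i, p i := by
      have h1 : algorithmOutput D d (constStep n) ⟨t, h⟩ * (D.a ⟨t, h⟩ ⬝ᵥ p) ≤ rbar :=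
        threshold_mul_dotProduct_le (hD _).1 _ _
      have h2 : dlow * ∑ i, p i ≤ p ⬝ᵥ d := by
        rw [Finset.mul_sum]
        refine Finset.sum_le_sum fun i _ => ?_
        rw [mul_comm]
        exact mul_le_mul_of_nonneg_left (hd i).1 (hp0 i)
      rw [dotProduct_sub, dotProduct_smul, smul_eq_mul, dotProduct_comm p]
      linarith
    have hcG : c ^ 2 * G ≤ c * G := mul_le_mul_of_nonneg_right (by nlinarith) hG0
    have hmain : dualPrice D d (constStep n) (t + 1) ⬝ᵥ dualPrice D d (constStep n) (t + 1) ≤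
        p ⬝ᵥ p + c * (2 * rbar + G - 2 * dlow * ∑ i, p i) := by
      nlinarith [mul_le_mul_of_nonneg_left hdrift hc0.le]
    rcases le_total (p ⬝ᵥ p) (K ^ 2) with hle | hge
    · have : c * (2 * rbar + G - 2 * dlow * ∑ i, p i) ≤ 2 * rbar + G := by
        have h3 : 0 ≤ dlow * ∑ i, p i := by positivity
        have h4 : c * (2 * rbar + G) ≤ 2 * rbar + G :=
          mul_le_of_le_one_left (by positivity) hc1
        nlinarith [mul_nonneg hc0.le h3]
      linarith
    -- For nonnegative `p` the 2-norm is at most the 1-norm.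
    · have hK1 : K ≤ ∑ i, p i := by
        refine le_of_sq_le_sq ?_ hsum0
        refine hge.trans ?_
        have := Finset.sum_sq_le_sq_sum_of_nonneg (s := Finset.univ) (f := p) fun i _ => hp0 i
        simpa [dotProduct, ← sq] using this
      have : 2 * rbar + G ≤ 2 * dlow * ∑ i, p i := by
        have := mul_le_mul_of_nonneg_left hK1 (show 0 ≤ 2 * dlow by positivity)
        rwa [hK, mul_div_cancel₀ _ (by positivity)] at this
      nlinarith

/-! ### Constraint violation -/

/-- Projection onto the orthant only raises prices, so they dominate the unprojected sum of steps.
-/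
theorem sum_residual_le_dualPrice (D : LPData m n) (d : Fin m → ℝ) (i : Fin m) (t : ℕ)
    (ht : t ≤ n) :
    1 / √(n : ℝ) * ∑ s : Fin t, (D.a (s.castLE ht) i *
      algorithmOutput D d (constStep n) (s.castLE ht) - d i) ≤
        dualPrice D d (constStep n) t i := by
  induction t with
  | zero => simp [dualPrice]
  | succ t ih =>
    have h := dualPrice_succ D d (constStep n) ⟨t, ht⟩
    simp only at h
    rw [Fin.sum_univ_castSucc, mul_add, h]
    refine le_trans ?_ (le_sup_left (a := _))
    have := ih (Nat.le_of_succ_le ht)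
    simp only [constStep, Pi.add_apply, Pi.smul_apply, Pi.sub_apply, smul_eq_mul] at *
    refine add_le_add this (le_of_eq ?_)
    rw [mul_comm (D.a _ i)]
    rfl

theorem violation_le {D : LPData m n} {rbar abar dlow dbar : ℝ} {d : Fin m → ℝ}
    (hdlow : 0 < dlow) (hD : D.BoundedBy rbar abar) (hd : ∀ i, dlow ≤ d i ∧ d i ≤ dbar)
    (hm : 0 < m) (hn : 0 < n) :
    D.violation ((n : ℝ) • d) (algorithmOutput D d (constStep n)) ≤
      √(((2 * rbar + (abar + dbar) ^ 2) / (2 * dlow)) ^ 2 +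
        (2 * rbar + (abar + dbar) ^ 2)) * (m * √(n : ℝ)) := by
  have hrbar : 0 ≤ rbar := (abs_nonneg _).trans (hD ⟨0, hn⟩).1
  have hm1 : (1 : ℝ) ≤ m := by exact_mod_cast hm
  have hn0 : (0 : ℝ) < n := by exact_mod_cast hn
  set p := dualPrice D d (constStep n) n with hp
  have hp0 : 0 ≤ p := dualPrice_nonneg _ _ _ _
  have hcoord : ∀ i, max (D.consumption (algorithmOutput D d (constStep n)) i -
      ((n : ℝ) • d) i) 0 ≤ √(n : ℝ) * p i := by
    intro i
    refine max_le ?_ (mul_nonneg (Real.sqrt_nonneg _) (hp0 i))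
    have h := sum_residual_le_dualPrice D d i n le_rfl
    rw [Finset.sum_sub_distrib, one_div, inv_mul_le_iff₀ (by positivity)] at h
    simpa [LPData.consumption] using h
  have hpp : p ⬝ᵥ p ≤ m ^ 2 * (((2 * rbar + (abar + dbar) ^ 2) / (2 * dlow)) ^ 2 +
      (2 * rbar + (abar + dbar) ^ 2)) := by
    refine (dualPrice_dotProduct_self_le hdlow hD hd hn n).trans ?_
    -- As `m ≥ 1`, a factor `m ^ 2` can be pulled out of the price bound, leaving a constant free of
    -- `m`.
    have h1 : 2 * rbar + m * (abar + dbar) ^ 2 ≤ m * (2 * rbar + (abar + dbar) ^ 2) := by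
      nlinarith
    have h2 : (2 * rbar + m * (abar + dbar) ^ 2) / (2 * dlow) ≤
        m * ((2 * rbar + (abar + dbar) ^ 2) / (2 * dlow)) := by
      rw [← mul_div_assoc]
      gcongr
    have h3 : m * (2 * rbar + (abar + dbar) ^ 2) ≤ m ^ 2 * (2 * rbar + (abar + dbar) ^ 2) := by
      gcongr
      nlinarith
    rw [mul_add, ← mul_pow]
    exact add_le_add (pow_le_pow_left₀ (by positivity) h2 2) (h1.trans h3)
  unfold LPData.violation
  rw [EuclideanSpace.norm_eq]
  refine Real.sqrt_le_iff.2 ⟨by positivity, ?_⟩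
  rw [mul_pow, mul_pow, Real.sq_sqrt (by positivity), Real.sq_sqrt hn0.le]
  calc _ ≤ ∑ i, (n : ℝ) * (p i * p i) := by
        refine Finset.sum_le_sum fun i _ => ?_
        have h := pow_le_pow_left₀ (le_max_right _ _) (hcoord i) 2
        rw [mul_pow, Real.sq_sqrt hn0.le] at h
        simpa [sq] using h
    _ = n * (p ⬝ᵥ p) := by rw [← Finset.mul_sum]; rfl
    _ ≤ n * _ := mul_le_mul_of_nonneg_left hpp hn0.le
    _ = _ := by ring

/-! ### Duality along the price path -/

/-- The `j`-th summand of the dual objective at the price vector `p`. -/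
def LPData.dualTerm (D : LPData m n) (d : Fin m → ℝ) (p : Fin m → ℝ) (j : Fin n) : ℝ :=
  d ⬝ᵥ p + max (D.r j - D.a j ⬝ᵥ p) 0

/-- The reward of the algorithm is, up to the drift of the prices, the dual objective along
the price path. -/
theorem sum_dualTerm_le_objective {D : LPData m n} {rbar abar dbar : ℝ} {d : Fin m → ℝ}
    (hD : D.BoundedBy rbar abar) (hd0 : 0 ≤ d) (hd : ∀ i, d i ≤ dbar) (hn : 0 < n) :
    ∑ t : Fin n, D.dualTerm d (dualPrice D d (constStep n) t) t ≤
      D.objective (algorithmOutput D d (constStep n)) +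
        (abar + dbar) ^ 2 / 2 * (m * √(n : ℝ)) := by
  have hn0 : (0 : ℝ) < n := by exact_mod_cast hn
  set q : ℕ → ℝ := fun t =>
    dualPrice D d (constStep n) t ⬝ᵥ dualPrice D d (constStep n) t with hq
  have hs : √(n : ℝ) * √(n : ℝ) = n := Real.mul_self_sqrt hn0.le
  have hs0 : 0 < √(n : ℝ) := by positivity
  have hterm : ∀ t : Fin n, D.dualTerm d (dualPrice D d (constStep n) t) t ≤
      D.r t * algorithmOutput D d (constStep n) t +
        (√(n : ℝ) / 2 * (q t - q (t + 1)) + (abar + dbar) ^ 2 / 2 * m / √(n : ℝ)) := by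
    intro t
    have h := dualPrice_succ_dotProduct_self_le hD hd0 hd t
    -- The factor `√n / 2` is `1 / (2 γ)`, which normalizes the inner product in the recursion.
    have h' := mul_le_mul_of_nonneg_left h (show 0 ≤ √(n : ℝ) / 2 by positivity)
    rw [dotProduct_sub, dotProduct_smul, smul_eq_mul] at h'
    have e : LPData.dualTerm D d (dualPrice D d (constStep n) t) t =
        dualPrice D d (constStep n) t ⬝ᵥ d + algorithmOutput D d (constStep n) t *
          (D.r t - dualPrice D d (constStep n) t ⬝ᵥ D.a t) := by
      rw [LPData.dualTerm, max_sub_dotProduct_eq, dotProduct_comm d,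
        dotProduct_comm _ (D.a t)]
      rfl
    rw [e]
    simp only [hq]
    have e2 : √(n : ℝ) / 2 * (1 / √(n : ℝ)) ^ 2 = 1 / 2 / √(n : ℝ) := by
      field_simp
    have e3 : √(n : ℝ) / 2 * (2 * (1 / √(n : ℝ))) = 1 := by
      field_simp
    rw [mul_add, mul_add, ← mul_assoc _ (2 * (1 / √(n : ℝ))), e3, ← mul_assoc _ (_ ^ 2), e2] at h'
    have e4 : (abar + dbar) ^ 2 / 2 * m / √(n : ℝ) =
        1 / 2 / √(n : ℝ) * (m * (abar + dbar) ^ 2) := by ring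
    rw [e4]
    nlinarith
  refine (Finset.sum_le_sum fun t _ => hterm t).trans ?_
  have htel : ∑ t : Fin n, (q t - q (t + 1)) = q 0 - q n := by
    rw [Fin.sum_univ_eq_sum_range fun t => q t - q (t + 1), Finset.sum_range_sub']
  have hq0 : q 0 = 0 := by simp [hq, dualPrice]
  have hqn : 0 ≤ q n := Finset.sum_nonneg fun i _ => mul_self_nonneg _
  rw [Finset.sum_add_distrib, Finset.sum_add_distrib, ← Finset.mul_sum, htel, hq0]
  have e5 : ∑ _t : Fin n, (abar + dbar) ^ 2 / 2 * m / √(n : ℝ) =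
      (abar + dbar) ^ 2 / 2 * (m * √(n : ℝ)) := by
    rw [Finset.sum_const, Finset.card_univ, Fintype.card_fin, nsmul_eq_mul, mul_div_assoc',
      div_eq_iff hs0.ne']
    linear_combination (-(abar + dbar) ^ 2 / 2 * m) * hs
  rw [e5]
  unfold LPData.objective
  nlinarith [mul_nonneg hs0.le hqn]

/-- Approximate weak duality on a subset of the columns: a fractional solution that exceeds the
proportional budget by at most `e` in every row can be rescaled to a feasible one. -/
theorem sum_mul_sub_le_sum_dualTerm {D : LPData m n} {rbar abar dlow : ℝ} {d : Fin m → ℝ}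
    (hdlow : 0 < dlow) (hD : D.BoundedBy rbar abar) (hd : ∀ i, dlow ≤ d i)
    {S : Finset (Fin n)} (hS : S.Nonempty) {x : Fin n → ℝ} (hx0 : 0 ≤ x) (hx1 : x ≤ 1)
    {p : Fin m → ℝ} (hp : 0 ≤ p) {e : ℝ} (he : 0 ≤ e)
    (hxe : ∀ i, ∑ j ∈ S, D.a j i * x j ≤ S.card * d i + e) :
    ∑ j ∈ S, D.r j * x j - rbar / dlow * e ≤ ∑ j ∈ S, D.dualTerm d p j := by
  have hs : (0 : ℝ) < S.card := by exact_mod_cast hS.card_pos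
  have hrbar : 0 ≤ rbar := (abs_nonneg _).trans (hD hS.choose).1
  set s := (S.card : ℝ) with hs_def
  -- `E` is the overshoot relative to the smallest possible budget `s * dlow`, so `s * d i + e ≤ s *
  -- d i * (1 + E)` and scaling by `l` restores feasibility.
  set E := e / (s * dlow) with hE
  have hE0 : 0 ≤ E := by positivity
  have hEe : E * (s * dlow) = e := by rw [hE]; field_simp
  set l := 1 / (1 + E) with hl
  have hl0 : 0 ≤ l := by positivity
  have hlE : l * (1 + E) = 1 := by rw [hl]; field_simp
  have hl1 : l ≤ 1 := by nlinarith
  have hfeas : ∀ i, l * ∑ j ∈ S, D.a j i * x j ≤ s * d i := by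
    intro i
    have h1 : e ≤ s * d i * E := by
      rw [← hEe]
      nlinarith [mul_le_mul_of_nonneg_left (hd i) (mul_nonneg hE0 hs.le)]
    calc l * ∑ j ∈ S, D.a j i * x j ≤ l * (s * d i * (1 + E)) :=
          mul_le_mul_of_nonneg_left (by linarith [hxe i]) hl0
      _ = s * d i * (l * (1 + E)) := by ring
      _ = s * d i := by rw [hlE, mul_one]
  have hterm : ∀ j ∈ S, d ⬝ᵥ p + l * (D.r j * x j) - l * (x j * (D.a j ⬝ᵥ p)) ≤
      D.dualTerm d p j := by
    intro j _
    unfold LPData.dualTerm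
    have h0 : 0 ≤ l * x j := mul_nonneg hl0 (hx0 j)
    have h1 : l * x j ≤ 1 := mul_le_one₀ hl1 (hx0 j) (hx1 j)
    have h2 : l * x j * (D.r j - D.a j ⬝ᵥ p) ≤ max (D.r j - D.a j ⬝ᵥ p) 0 :=
      (mul_le_mul_of_nonneg_left (le_max_left _ _) h0).trans
        (mul_le_of_le_one_left (le_max_right _ _) h1)
    linarith
  have hcons : l * ∑ j ∈ S, x j * (D.a j ⬝ᵥ p) ≤ s * (d ⬝ᵥ p) := by
    have h1 : l * ∑ j ∈ S, x j * (D.a j ⬝ᵥ p) = ∑ i, (l * ∑ j ∈ S, D.a j i * x j) * p i := by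
      simp only [dotProduct, Finset.mul_sum, Finset.sum_mul]
      rw [Finset.sum_comm]
      refine Finset.sum_congr rfl fun i _ => Finset.sum_congr rfl fun j _ => ?_
      ring
    rw [h1, dotProduct, Finset.mul_sum]
    refine Finset.sum_le_sum fun i _ => ?_
    rw [← mul_assoc]
    exact mul_le_mul_of_nonneg_right (hfeas i) (hp i)
  have hrew : ∑ j ∈ S, D.r j * x j ≤ s * rbar := by
    calc ∑ j ∈ S, D.r j * x j ≤ ∑ _j ∈ S, rbar := by
          refine Finset.sum_le_sum fun j _ => ?_
          have h1 := (hD j).1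
          have h2 : x j ≤ 1 := hx1 j
          calc D.r j * x j ≤ rbar * x j :=
                mul_le_mul_of_nonneg_right ((le_abs_self _).trans h1) (hx0 j)
            _ ≤ rbar := mul_le_of_le_one_right hrbar h2
      _ = s * rbar := by simp [hs_def]
  have hloss : (1 - l) * ∑ j ∈ S, D.r j * x j ≤ rbar / dlow * e := by
    have h1 : (1 - l) * ∑ j ∈ S, D.r j * x j ≤ (1 - l) * (s * rbar) :=
      mul_le_mul_of_nonneg_left hrew (by linarith)
    have h2 : 1 - l ≤ E := by nlinarith
    have h3 : E * (s * rbar) = rbar / dlow * e := by rw [hE]; field_simp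
    rw [← h3]
    exact h1.trans (mul_le_mul_of_nonneg_right h2 (by positivity))
  have hsum := Finset.sum_le_sum hterm
  rw [Finset.sum_sub_distrib, Finset.sum_add_distrib, Finset.sum_const, nsmul_eq_mul,
    ← Finset.mul_sum, ← Finset.mul_sum] at hsum
  linarith

/-! ### Exchangeability and the expected dual term -/

theorem dualPrice_permute_mul_swap (D : LPData m n) (d : Fin m → ℝ) (γ : Fin n → ℝ)
    (σ : Equiv.Perm (Fin n)) {t k : Fin n} (htk : t ≤ k) :
    dualPrice (D.permute (σ * Equiv.swap t k)) d γ t = dualPrice (D.permute σ) d γ t := by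
  have h : ∀ j : Fin n, (j : ℕ) < t → (σ * Equiv.swap t k) j = σ j := by
    intro j hj
    have h1 : j ≠ t := by rintro rfl; exact lt_irrefl _ hj
    have h2 : j ≠ k := by rintro rfl; exact absurd hj (not_lt.2 htk)
    rw [Equiv.Perm.mul_apply, Equiv.swap_apply_of_ne_of_ne h1 h2]
  refine dualPrice_congr d γ t ?_ ?_ <;> intro j hj <;> simp only [LPData.permute, h j hj]

/-- The column at time `t` and all later ones are exchangeable given the price at time `t`. -/
theorem card_mul_expect_dualTerm (D : LPData m n) (d : Fin m → ℝ) (γ : Fin n → ℝ) (t : Fin n) :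
    (Finset.Ici t).card * 𝔼 σ : Equiv.Perm (Fin n),
        (D.permute σ).dualTerm d (dualPrice (D.permute σ) d γ t) t =
      𝔼 σ : Equiv.Perm (Fin n), ∑ k ∈ Finset.Ici t,
        (D.permute σ).dualTerm d (dualPrice (D.permute σ) d γ t) k := by
  rw [Finset.expect_sum_comm, ← nsmul_eq_mul, ← Finset.sum_const]
  refine Finset.sum_congr rfl fun k hk => ?_
  rw [← expect_perm_mul_right (Equiv.swap t k)]
  refine Finset.expect_congr rfl fun σ _ => ?_
  rw [dualPrice_permute_mul_swap D d γ σ (Finset.mem_Ici.1 hk)]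
  simp [LPData.dualTerm, LPData.permute]

/-- The expected dual term at time `t`, when `s` columns remain, is at least the offline optimum
per column up to `O(√(m / s))`. -/
theorem optimalValue_div_sub_le_expect_dualTerm {D : LPData m n} {rbar abar dlow : ℝ}
    {d : Fin m → ℝ} (hdlow : 0 < dlow) (hD : D.BoundedBy rbar abar) (hd : ∀ i, dlow ≤ d i)
    (hm : 0 < m) (t : Fin n) :
    D.optimalValue ((n : ℝ) • d) / n -
        rbar * (1 + abar ^ 2) / (2 * dlow) * √(m : ℝ) * (1 / √((Finset.Ici t).card : ℝ)) ≤
      𝔼 σ : Equiv.Perm (Fin n),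
        (D.permute σ).dualTerm d (dualPrice (D.permute σ) d (constStep n) t) t := by
  have hn : 0 < n := t.pos
  have hn0 : (0 : ℝ) < n := by exact_mod_cast hn
  have hm0 : (0 : ℝ) < m := by exact_mod_cast hm
  have hrbar : 0 ≤ rbar := (abs_nonneg _).trans (hD t).1
  have hb : 0 ≤ (n : ℝ) • d := smul_nonneg hn0.le fun i => hdlow.le.trans (hd i)
  obtain ⟨x, ⟨hxb, hx0, hx1⟩, hxval⟩ := (D.isGreatest_optimalValue _ hb).1
  set S := Finset.Ici t with hS
  have hSne : S.Nonempty := ⟨t, by simp [hS]⟩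
  set s := (S.card : ℝ) with hs
  have hs0 : 0 < s := by rw [hs]; exact_mod_cast hSne.card_pos
  set w : Fin m → Equiv.Perm (Fin n) → ℝ := fun i σ =>
    ∑ k ∈ S, (D.a (σ k) i * x (σ k) - (∑ j, D.a j i * x j) / n) with hw
  have hwvar : ∀ i, 𝔼 σ, w i σ ^ 2 ≤ s * abar ^ 2 := fun i =>
    expect_sum_sub_mean_sq_le (fun j => D.a j i * x j) (fun j => by
      rw [abs_mul, abs_of_nonneg (hx0 j)]
      exact (mul_le_of_le_one_right (abs_nonneg _) (hx1 j)).trans (hD.abs_entry_le j i)) S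
  -- `c` is the typical size of the overshoot. The bound `w ≤ (c + w ^ 2 / c) / 2` makes second
  -- moments suffice, and summing the squares over rows gives one overshoot valid for every row.
  set c := √((m : ℝ) * s) with hc
  have hc0 : 0 < c := by positivity
  have hcc : c * c = m * s := Real.mul_self_sqrt (by positivity)
  have hpoint : ∀ σ : Equiv.Perm (Fin n),
      ∑ k ∈ S, D.r (σ k) * x (σ k) - rbar / dlow * ((c + (∑ i, w i σ ^ 2) / c) / 2) ≤
        ∑ k ∈ S, (D.permute σ).dualTerm d (dualPrice (D.permute σ) d (constStep n) t) k := by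
    intro σ
    have hW : 0 ≤ ∑ i, w i σ ^ 2 := Finset.sum_nonneg fun i _ => sq_nonneg _
    refine sum_mul_sub_le_sum_dualTerm (x := fun k => x (σ k)) hdlow (hD.permute σ) hd hSne
      (fun k => hx0 (σ k)) (fun k => hx1 (σ k)) (dualPrice_nonneg _ _ _ _) (by positivity) fun i => ?_
    have h1 : w i σ ≤ (c + (∑ i, w i σ ^ 2) / c) / 2 := by
      have h2 : w i σ ^ 2 ≤ ∑ i, w i σ ^ 2 :=
        Finset.single_le_sum (f := fun i => w i σ ^ 2) (fun i _ => sq_nonneg _)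
          (Finset.mem_univ i)
      have h3 : w i σ ≤ (c + w i σ ^ 2 / c) / 2 := by
        have : (c + w i σ ^ 2 / c) / 2 - w i σ = (c - w i σ) ^ 2 / (2 * c) := by
          field_simp
          ring
        have : 0 ≤ (c - w i σ) ^ 2 / (2 * c) := by positivity
        linarith
      have h4 : w i σ ^ 2 / c ≤ (∑ i, w i σ ^ 2) / c := by gcongr
      linarith
    have h5 : (∑ j, D.a j i * x j) / n ≤ d i := by
      rw [div_le_iff₀ hn0, mul_comm]
      exact hxb i
    have h6 : ∑ k ∈ S, D.a (σ k) i * x (σ k) = w i σ + s * ((∑ j, D.a j i * x j) / n) := by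
      simp [hw, hs, Finset.sum_sub_distrib]
    have h7 := mul_le_mul_of_nonneg_left h5 hs0.le
    change ∑ k ∈ S, D.a (σ k) i * x (σ k) ≤ _
    rw [h6]
    linarith
  have hE := Finset.expect_le_expect (s := Finset.univ) fun σ _ => hpoint σ
  rw [← card_mul_expect_dualTerm, Finset.expect_sub_distrib, Finset.expect_sum_comm,
    ← Finset.mul_expect, ← Finset.expect_div, Finset.expect_add_distrib,
    ← Finset.expect_div, Finset.expect_sum_comm, Fintype.expect_const] at hE
  have hopt : ∑ k ∈ S, 𝔼 σ : Equiv.Perm (Fin n), D.r (σ k) * x (σ k) =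
      s * (D.optimalValue ((n : ℝ) • d) / n) := by
    rw [← hxval, Finset.sum_congr rfl fun k _ => expect_apply_eq (fun j => D.r j * x j) k]
    simp [hs, LPData.objective]
  rw [hopt] at hE
  have hvar : (∑ i, 𝔼 σ, w i σ ^ 2) / c ≤ abar ^ 2 * c := by
    rw [div_le_iff₀ hc0, mul_assoc, hcc]
    calc ∑ i, 𝔼 σ, w i σ ^ 2 ≤ ∑ _i : Fin m, s * abar ^ 2 :=
          Finset.sum_le_sum fun i _ => hwvar i
      _ = abar ^ 2 * (m * s) := by simp; ring
  have herr : rbar / dlow * ((c + (∑ i, 𝔼 σ, w i σ ^ 2) / c) / 2) ≤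
      s * (rbar * (1 + abar ^ 2) / (2 * dlow) * √(m : ℝ) * (1 / √s)) := by
    have h1 : s * (1 / √s) = √s := by
      rw [mul_one_div, Real.div_sqrt]
    have h2 : c = √(m : ℝ) * √s := Real.sqrt_mul hm0.le _
    calc _ ≤ rbar / dlow * ((c + abar ^ 2 * c) / 2) := by gcongr
      _ = rbar * (1 + abar ^ 2) / (2 * dlow) * c := by field_simp
      _ = rbar * (1 + abar ^ 2) / (2 * dlow) * √(m : ℝ) * (s * (1 / √s)) := by
        rw [h1, h2]; ring
      _ = _ := by ring
  refine le_of_mul_le_mul_left ?_ hs0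
  rw [mul_sub]
  linarith

/-! ### Summing the errors -/

/-- Telescoping: `1 / √(k + 1) ≤ 2 (√(k + 1) - √k)`. -/
theorem sum_range_one_div_sqrt_le (n : ℕ) :
    ∑ k ∈ Finset.range n, 1 / √((k + 1 : ℕ) : ℝ) ≤ 2 * √(n : ℝ) := by
  induction n with
  | zero => simp
  | succ n ih =>
    rw [Finset.sum_range_succ]
    have h1 : √(n : ℝ) * √(n : ℝ) = n := Real.mul_self_sqrt (by positivity)
    have h2 : √((n + 1 : ℕ) : ℝ) * √((n + 1 : ℕ) : ℝ) = n + 1 := by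
      rw [Real.mul_self_sqrt (by positivity)]; push_cast; ring
    have h3 : 0 < √((n + 1 : ℕ) : ℝ) := by positivity
    have h4 : 1 / √((n + 1 : ℕ) : ℝ) ≤ 2 * √((n + 1 : ℕ) : ℝ) - 2 * √(n : ℝ) := by
      rw [div_le_iff₀ h3]
      nlinarith [sq_nonneg (√((n + 1 : ℕ) : ℝ) - √(n : ℝ))]
    linarith

theorem sum_one_div_sqrt_card_Ici_le (n : ℕ) :
    ∑ t : Fin n, 1 / √((Finset.Ici t).card : ℝ) ≤ 2 * √(n : ℝ) := by
  refine le_trans (le_of_eq ?_) (sum_range_one_div_sqrt_le n)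
  rw [← Finset.sum_range_reflect, ← Fin.sum_univ_eq_sum_range
    (fun k => 1 / √((n - 1 - k + 1 : ℕ) : ℝ))]
  refine Finset.sum_congr rfl fun t _ => ?_
  rw [Fin.card_Ici]
  congr 4
  omega

theorem optimalValue_sub_expectedReward_le {D : LPData m n} {rbar abar dlow dbar : ℝ}
    {d : Fin m → ℝ} (hdlow : 0 < dlow) (hD : D.BoundedBy rbar abar)
    (hd : ∀ i, dlow ≤ d i ∧ d i ≤ dbar) (hm : 0 < m) (hn : 0 < n) :
    D.optimalValue ((n : ℝ) • d) - expectedReward D d ≤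
      ((abar + dbar) ^ 2 / 2 + rbar * (1 + abar ^ 2) / dlow) * (m * √(n : ℝ)) := by
  have hn0 : (0 : ℝ) < n := by exact_mod_cast hn
  have hm1 : (1 : ℝ) ≤ m := by exact_mod_cast hm
  have hrbar : 0 ≤ rbar := (abs_nonneg _).trans (hD ⟨0, hn⟩).1
  have hd0 : 0 ≤ d := fun i => hdlow.le.trans (hd i).1
  have hreward := Finset.expect_le_expect (s := Finset.univ) fun (σ : Equiv.Perm (Fin n)) _ =>
    sum_dualTerm_le_objective (hD.permute σ) hd0 (fun i => (hd i).2) hn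
  rw [Finset.expect_sum_comm, Finset.expect_add_distrib, Fintype.expect_const] at hreward
  have hdual := Finset.sum_le_sum (s := Finset.univ) fun (t : Fin n) _ =>
    optimalValue_div_sub_le_expect_dualTerm hdlow hD (fun i => (hd i).1) hm t
  rw [Finset.sum_sub_distrib, ← Finset.mul_sum, Finset.sum_const, Finset.card_univ,
    Fintype.card_fin, nsmul_eq_mul, mul_div_cancel₀ _ hn0.ne'] at hdual
  -- The sampling error `√(m n)` is absorbed into the `m √n` of the potential argument.
  have hsqrt : √(m : ℝ) ≤ m := Real.sqrt_le_iff.2 ⟨by positivity, by nlinarith⟩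
  have herr : rbar * (1 + abar ^ 2) / (2 * dlow) * √(m : ℝ) *
      ∑ t : Fin n, 1 / √((Finset.Ici t).card : ℝ) ≤
        rbar * (1 + abar ^ 2) / dlow * (m * √(n : ℝ)) := by
    calc _ ≤ rbar * (1 + abar ^ 2) / (2 * dlow) * m * (2 * √(n : ℝ)) := by
          gcongr
          exact sum_one_div_sqrt_card_Ici_le n
      _ = _ := by field_simp
  unfold expectedReward
  linarith

end OnlineLP

end

theorem theorem2 (rbar abar dlow dbar : ℝ) (hdlow : 0 < dlow) :
    ∃ C₁ C₂ : ℝ, ∀ m n : ℕ, 0 < m → 0 < n →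
      ∀ (D : OnlineLP.LPData m n) (d : Fin m → ℝ),
        D.BoundedBy rbar abar →
        (∀ i, dlow ≤ d i ∧ d i ≤ dbar) →
        D.GeneralPosition →
        D.optimalValue ((n : ℝ) • d) - OnlineLP.expectedReward D d
            ≤ C₁ * (((m : ℝ) + Real.log (n : ℝ)) * √(n : ℝ)) ∧
          OnlineLP.expectedViolation D d ≤ C₂ * ((m : ℝ) * √(n : ℝ)) := by
  refine ⟨(abar + dbar) ^ 2 / 2 + rbar * (1 + abar ^ 2) / dlow,
    √(((2 * rbar + (abar + dbar) ^ 2) / (2 * dlow)) ^ 2 + (2 * rbar + (abar + dbar) ^ 2)), ?_⟩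
  intro m n hm hn D d hD hd _
  have hrbar : 0 ≤ rbar := (abs_nonneg _).trans (hD ⟨0, hn⟩).1
  constructor
  · refine (OnlineLP.optimalValue_sub_expectedReward_le hdlow hD hd hm hn).trans ?_
    -- The bound `m √n` is already established; the nonnegative logarithm only weakens it.
    have hlog : 0 ≤ Real.log n := Real.log_natCast_nonneg n
    gcongr
    linarith
  · exact Finset.expect_le Finset.univ_nonempty fun σ _ =>
      OnlineLP.violation_le hdlow (hD.permute σ) hd hm hn
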